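/- All commutators are $[g,h]=g^{-1}h^{-1}gh$. For a group $G$, the enhanced power graph $\mathcal{P}_e(G)$ is the simple graph with vertex set $G$ in which distinct $x,y$ are adjacent if and only if $\langle x,y\rangle$ is cyclic. A stem extension of $G$ is a surjective homomorphism $\pi:E\to G$ of groups with $\ker\pi\subseteq Z(E)\cap E'$; a Schur cover of a finite group $G$ is a stem extension $\pi:\tilde G\to G$ with $|\tilde G|$ maximal. The deep commuting graph $\Delta_D(G)$ is the simple graph with vertex set $G$ in which distinct $x,y$ are adjacent if and only if their preimages commute in a Schur cover $\tilde G$ of $G$. Let $p$ be an odd prime, let $k\ge 1$ be an integer, and let $$H_3(\mathbb{Z}/p^k\mathbb{Z})=\langle y_1,y_2,w \mid [y_1,y_2]=w,\ y_1^{p^k}=y_2^{p^k}=w^{p^k}=e=[y_1,w]=[y_2,w]\rangle .$$ (a) Let $\tilde H$ be the group with generators $\tilde y_1,\tilde y_2,\tilde w,w_1,w_2$ and relations $[\tilde y_1,\tilde y_2]=\tilde w$, $[\tilde y_1,\tilde w]=w_1$, $[\tilde y_2,\tilde w]=w_2$, $\tilde y_1^{p^k}=\tilde y_2^{p^k}=\tilde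 w^{p^k}=w_1^{p^k}=w_2^{p^k}=e$, together with the vanishing of the fourth term $\gamma_4$ of the lower central series. Then there is a homomorphism $\pi:\tilde H\to H_3(\mathbb{Z}/p^k\mathbb{Z})$ with $\pi(\tilde y_1)=y_1$, $\pi(\tilde y_2)=y_2$, $\pi(\tilde w)=w$ that is a Schur cover of $H_3(\mathbb{Z}/p^k\mathbb{Z})$, and its kernel (the Schur multiplier) is isomorphic to $C_{p^k}\times C_{p^k}$. The group $\tilde H$ has nilpotency class exactly $3$. (b) Whichever Schur cover of $H_3(\mathbb{Z}/p^k\mathbb{Z})$ is used to define $\Delta_D$, $$\mathcal{P}_e(H_3(\mathbb{Z}/p^k\mathbb{Z}))=\Delta_D(H_3(\mathbb{Z}/p^k\mathbb{Z}))\quad\text{if and only if}\quad k=1 .$$ -/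

import Mathlib

namespace DeepCommuting

universe u v

/-- The commutator in the convention `[g, h] = g⁻¹ h⁻¹ g h`. -/
def comm {G : Type u} [Group G] (g h : G) : G := g⁻¹ * h⁻¹ * g * h

/-- The enhanced power graph: distinct `x`, `y` are adjacent iff `⟨x, y⟩` is cyclic. -/
def enhancedPowerGraph (G : Type u) [Group G] : SimpleGraph G where
  Adj x y := x ≠ y ∧ IsCyclic (Subgroup.closure ({x, y} : Set G))
  symm := ⟨fun x y h => ⟨h.1.symm, by rw [Set.pair_comm y x]; exact h.2⟩⟩
  loopless := ⟨fun _ h => h.1 rfl⟩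

/-- `π : E → G` is a stem extension of `G`: it is onto and its kernel lies in `Z(E) ∩ E'`. -/
structure IsStemExtension {E : Type v} {G : Type u} [Group E] [Group G] (π : E →* G) : Prop where
  surjective : Function.Surjective π
  ker_le_center : π.ker ≤ Subgroup.center E
  ker_le_commutator : π.ker ≤ commutator E

/-- `π : E → G` is a Schur cover of the finite group `G`: a stem extension of maximal order.
All stem extensions of a finite group are finite, so it is enough to compare with
those living in the universe of `G`. -/
structure IsSchurCover {E : Type v} {G : Type u} [Group E] [Group G] (π : E →* G) : Prop where
  stem : IsStemExtension π
  card_le : ∀ (F : Type u) [Group F] (ρ : F →* G), IsStemExtension ρ → Nat.card F ≤ Nat.card E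

/-- The deep commuting graph of `G`, computed in the Schur cover `π : E → G`: distinct `x`, `y`
are adjacent iff their preimages commute in `E`. -/
def deepCommutingGraph {E : Type v} {G : Type u} [Group E] [Group G] (π : E →* G) :
    SimpleGraph G where
  Adj x y := x ≠ y ∧ ∀ a b : E, π a = x → π b = y → Commute a b
  symm := ⟨fun _ _ h => ⟨h.1.symm, fun a b ha hb => (h.2 b a hb ha).symm⟩⟩
  loopless := ⟨fun _ h => h.1 rfl⟩

/-- The generators of the Heisenberg group. -/
inductive HGen : Type
  | y₁ | y₂ | w

open FreeGroup in
/-- The relations `[y₁, y₂] = w`, `y₁ⁿ = y₂ⁿ = wⁿ = e`, `[y₁, w] = [y₂, w] = e`. -/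
def heisenbergRels (n : ℕ) : Set (FreeGroup HGen) :=
  {comm (of .y₁) (of .y₂) * (of .w)⁻¹,
   of .y₁ ^ n, of .y₂ ^ n, of .w ^ n,
   comm (of .y₁) (of .w), comm (of .y₂) (of .w)}

/-- The Heisenberg group `H₃(ℤ/nℤ)`, by its presentation. -/
abbrev Heisenberg (n : ℕ) : Type := PresentedGroup (heisenbergRels n)

/-- The generators of the covering group of the Heisenberg group. -/
inductive CGen : Type
  | y₁ | y₂ | w | w₁ | w₂

open FreeGroup in
/-- The relations `[y₁, y₂] = w`, `[y₁, w] = w₁`, `[y₂, w] = w₂`, all five generators have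
`n`-th power `e`, and the group is nilpotent of class at most `3`: the last set is the fourth term
`γ₄` of the lower central series of the free group (Mathlib numbers the series from `0`). -/
def heisenbergCoverRels (n : ℕ) : Set (FreeGroup CGen) :=
  {comm (of .y₁) (of .y₂) * (of .w)⁻¹,
   comm (of .y₁) (of .w) * (of .w₁)⁻¹, comm (of .y₂) (of .w) * (of .w₂)⁻¹,
   of .y₁ ^ n, of .y₂ ^ n, of .w ^ n, of .w₁ ^ n, of .w₂ ^ n}
  ∪ ((⊤ : Subgroup (FreeGroup CGen)).lowerCentralSeries 3 : Set (FreeGroup CGen))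

/-- The covering group of `H₃(ℤ/nℤ)`, by its presentation as a group of class `3`. -/
abbrev HeisenbergCover (n : ℕ) : Type := PresentedGroup (heisenbergCoverRels n)

end DeepCommuting

open DeepCommuting

/-!
Let `n` be odd. Both `H₃(ℤ/n)` and its covering group have logarithmic coordinates in which powers
are scalar multiples. Hence two elements of `H₃(ℤ/n)` lie in a common cyclic subgroup iff their
coordinate vectors are multiples of a common vector, and their lifts to the covering group commute
iff the `2 × 2` minors of these vectors vanish. Over `ℤ/n` the second condition implies the first
iff `ℤ/n` is reduced, that is, `n` is squarefree.

Neither the maximal order of a stem extension nor the commutation of lifts to a Schur cover needs a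
classification of the covers. In a central extension of `H₃(ℤ/n)` the commutator subgroup meets the
kernel in the group generated by `[a, [a, b]]` and `[b, [a, b]]`, where `a`, `b` lift `y₁`, `y₂`;
its order is at most `n²`. For the fibre product `P` of two Schur covers `E`, `F`, whose kernels
have order `n²`, it follows that the commutator subgroup of `P` maps injectively to `E` and to `F`,
so a commutator of lifts is trivial in `E` iff it is trivial in `F`.
-/

namespace DeepCommuting

/-! ### Vectors with vanishing minors -/

section MinorsVanish

variable {ι R : Type*} [CommRing R]

/-- All `2 × 2` minors of the two-row matrix with rows `x` and `y` vanish. In logarithmic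
coordinates this is the commutation relation of the covering group. -/
def MinorsVanish (x y : ι → R) : Prop :=
  ∀ i j, x i * y j = x j * y i

theorem minorsVanish_of_mem_span_singleton {x y z : ι → R} (hx : x ∈ R ∙ z) (hy : y ∈ R ∙ z) :
    MinorsVanish x y := by
  obtain ⟨a, rfl⟩ := Submodule.mem_span_singleton.1 hx
  obtain ⟨b, rfl⟩ := Submodule.mem_span_singleton.1 hy
  intro i j
  simp only [Pi.smul_apply, smul_eq_mul]
  ring

theorem MinorsVanish.exists_mem_span_singleton [Finite ι] [IsSemisimpleRing R] {x y : ι → R}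
    (h : MinorsVanish x y) : ∃ z, x ∈ R ∙ z ∧ y ∈ R ∙ z := by
  have := Fintype.ofFinite ι
  -- The ideal of the entries of `x` is generated by an idempotent `e = ∑ i, t i * x i`.
  obtain ⟨J, hJ⟩ := exists_isCompl (Ideal.span (Set.range x))
  obtain ⟨e, he, f, hf, hef⟩ :=
    Submodule.mem_sup.1 (hJ.sup_eq_top ▸ Submodule.mem_top (x := (1 : R)))
  have hfx (i : ι) : f * x i = 0 := (Submodule.disjoint_def.1 hJ.disjoint) _
    (Ideal.mul_mem_left _ _ (Ideal.subset_span ⟨i, rfl⟩)) (Ideal.mul_mem_right _ _ hf)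
  obtain ⟨t, ht⟩ := (Ideal.mem_span_range_iff_exists_fun).1 he
  have hey (i : ι) : e * y i = (∑ j, t j * y j) * x i := by
    rw [← ht, Finset.sum_mul, Finset.sum_mul]
    exact Finset.sum_congr rfl fun j _ => by linear_combination t j * h j i
  have hfe : f * e = 0 := by
    rw [← ht, Finset.mul_sum]
    exact Finset.sum_eq_zero fun j _ => by rw [mul_left_comm, hfx, mul_zero]
  refine ⟨x + f • y, Submodule.mem_span_singleton.2 ⟨e, ?_⟩,
    Submodule.mem_span_singleton.2 ⟨e * (∑ j, t j * y j) + f, ?_⟩⟩ <;> ext i <;>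
    simp only [Pi.smul_apply, Pi.add_apply, smul_eq_mul]
  · linear_combination x i * hef - hfx i + y i * hfe
  · linear_combination -e * hey i + (∑ j, t j * y j - 2) * y i * hfe + hfx i +
      y i * (e + f + 1) * hef

theorem eq_zero_of_single_mem_span_singleton [DecidableEq ι] [IsBezout R] {i j : ι} (hij : i ≠ j)
    {r : R} {z : ι → R} (hi : Pi.single i r ∈ R ∙ z) (hj : Pi.single j r ∈ R ∙ z) : r = 0 := by
  obtain ⟨s, hs⟩ := Submodule.mem_span_singleton.1 hi
  obtain ⟨t, ht⟩ := Submodule.mem_span_singleton.1 hj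
  have hsi : s * z i = r := by simpa using congrFun hs i
  have hsj : s * z j = 0 := by simpa [hij.symm] using congrFun hs j
  have hti : t * z i = 0 := by simpa [hij] using congrFun ht i
  have htj : t * z j = r := by simpa using congrFun ht j
  obtain ⟨α, β, hg⟩ := IsBezout.gcd_eq_sum (z i) (z j)
  obtain ⟨a, ha⟩ := IsBezout.gcd_dvd_left (z i) (z j)
  obtain ⟨b, hb⟩ := IsBezout.gcd_dvd_right (z i) (z j)
  have hsg : s * IsBezout.gcd (z i) (z j) = α * r := by
    rw [← hg]
    linear_combination α * hsi + β * hsj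
  have htg : t * IsBezout.gcd (z i) (z j) = β * r := by
    rw [← hg]
    linear_combination α * hti + β * htj
  calc
    r = α * r * a := by rw [← hsg, mul_assoc, ← ha, hsi]
    _ = α * (β * r * b) * a := by rw [← htg, mul_assoc t, ← hb, htj]
    _ = α * b * (β * r * a) := by ring
    _ = 0 := by rw [← htg, mul_assoc t, ← ha, hti, mul_zero]

theorem forall_minorsVanish_exists_iff_isReduced [Finite ι] [Nontrivial ι] [IsArtinianRing R]
    [IsBezout R] :
    (∀ x y : ι → R, MinorsVanish x y → ∃ z, x ∈ R ∙ z ∧ y ∈ R ∙ z) ↔ IsReduced R := by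
  classical
  constructor
  · rw [isReduced_iff_pow_one_lt 2 one_lt_two]
    intro h r hr
    obtain ⟨i, j, hij⟩ := exists_pair_ne ι
    obtain ⟨z, hi, hj⟩ := h (Pi.single i r) (Pi.single j r) fun k l => by
      simp only [Pi.single_apply]
      split_ifs <;> simp [← sq, hr]
    exact eq_zero_of_single_mem_span_singleton hij hi hj
  · intro _ x y h
    have := IsArtinianRing.isSemisimpleRing_of_isReduced R
    exact h.exists_mem_span_singleton

end MinorsVanish

/-! ### Commutators and central subgroups -/

section Commutators

variable {G H : Type*} [Group G] [Group H]

theorem map_comm (f : G →* H) (g h : G) : f (comm g h) = comm (f g) (f h) := by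
  simp [comm]

theorem comm_eq_iff {g h z : G} : comm g h = z ↔ g * h = h * g * z := by
  simp [comm, mul_assoc, inv_mul_eq_iff_eq_mul]

theorem comm_eq_one_iff {g h : G} : comm g h = 1 ↔ Commute g h := by
  rw [comm_eq_iff, mul_one, commute_iff_eq]

open scoped commutatorElement in
theorem comm_eq_commutatorElement (g h : G) : comm g h = ⁅g⁻¹, h⁻¹⁆ := by
  simp [comm, commutatorElement_def]

theorem comm_mem {K : Subgroup G} {g h : G} (hg : g ∈ K) (hh : h ∈ K) : comm g h ∈ K :=
  mul_mem (mul_mem (mul_mem (inv_mem hg) (inv_mem hh)) hg) hh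

theorem comm_mem_commutator (g h : G) : comm g h ∈ commutator G := by
  rw [comm_eq_commutatorElement]
  exact Subgroup.commutator_mem_commutator (Subgroup.mem_top _) (Subgroup.mem_top _)

theorem comm_mem_lowerCentralSeries_succ {i : ℕ} (g : G) {h : G}
    (hh : h ∈ (⊤ : Subgroup G).lowerCentralSeries i) :
    comm g h ∈ (⊤ : Subgroup G).lowerCentralSeries (i + 1) := by
  rw [comm_eq_commutatorElement, ← commutatorElement_inv, Subgroup.lowerCentralSeries_succ]
  exact inv_mem (Subgroup.commutator_mem_commutator (inv_mem hh) (Subgroup.mem_top _))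

theorem comm_comm_mem_lowerCentralSeries_two (g h k : G) :
    comm g (comm h k) ∈ (⊤ : Subgroup G).lowerCentralSeries 2 :=
  comm_mem_lowerCentralSeries_succ g
    (comm_mem_lowerCentralSeries_succ (i := 0) h (Subgroup.mem_top k))

theorem comm_pow_left {g h : G} (hc : comm g h ∈ Subgroup.center G) (n : ℕ) :
    comm (g ^ n) h = comm g h ^ n := by
  have hconj : h⁻¹ * g * h = g * comm g h := by simp [comm, mul_assoc]
  have hconj_pow : h⁻¹ * g ^ n * h = (h⁻¹ * g * h) ^ n := by
    simpa using (conj_pow (a := h⁻¹) (b := g) (i := n)).symm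
  have hcomm : Commute g (comm g h) := Subgroup.mem_center_iff.1 hc g
  rw [comm_eq_iff, mul_assoc, ← hcomm.mul_pow, ← hconj, ← hconj_pow]
  group

theorem comm_pow_eq_one {g h : G} {n : ℕ} (hc : comm g h ∈ Subgroup.center G)
    (hg : g ^ n ∈ Subgroup.center G) : comm g h ^ n = 1 := by
  rw [← comm_pow_left hc, comm_eq_one_iff]
  exact (Subgroup.mem_center_iff.1 hg h).symm

theorem normal_of_le_center {N : Subgroup G} (hN : N ≤ Subgroup.center G) : N.Normal :=
  ⟨fun x hx g => by rwa [Subgroup.mem_center_iff.1 (hN hx) g, mul_inv_cancel_right]⟩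

theorem map_center_le_center {f : G →* H} (hf : Function.Surjective f) :
    (Subgroup.center G).map f ≤ Subgroup.center H := by
  rintro _ ⟨z, hz, rfl⟩
  rw [Subgroup.mem_center_iff, hf.forall]
  intro g
  rw [← map_mul, ← map_mul, Subgroup.mem_center_iff.1 hz]

theorem map_commutator_eq_commutator {f : G →* H} (hf : Function.Surjective f) :
    (commutator G).map f = commutator H := by
  rw [commutator_def, commutator_def, Subgroup.map_commutator,
    Subgroup.map_top_of_surjective f hf]

theorem mem_center_of_closure_sup_center_eq_top {S : Set G} {g : G}
    (hS : Subgroup.closure S ⊔ Subgroup.center G = ⊤) (hg : ∀ s ∈ S, Commute s g) :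
    g ∈ Subgroup.center G := by
  have hle : Subgroup.closure S ⊔ Subgroup.center G ≤ Subgroup.centralizer {g} := by
    refine sup_le ((Subgroup.closure_le _).2 fun s hs => ?_) (Subgroup.center_le_centralizer _)
    exact Subgroup.mem_centralizer_singleton_iff.2 (hg s hs).eq
  rw [hS] at hle
  exact Subgroup.mem_center_iff.2 fun x =>
    Subgroup.mem_centralizer_singleton_iff.1 (hle (Subgroup.mem_top x))

theorem closure_image_sup_center_eq_top {S : Set G} {f : G →* H} (hf : Function.Surjective f)
    (hS : Subgroup.closure S ⊔ Subgroup.center G = ⊤) :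
    Subgroup.closure (f '' S) ⊔ Subgroup.center H = ⊤ := by
  have hmap := congrArg (Subgroup.map f) hS
  rw [Subgroup.map_sup, MonoidHom.map_closure, Subgroup.map_top_of_surjective f hf] at hmap
  exact top_le_iff.1 (hmap.ge.trans (sup_le_sup_left (map_center_le_center hf) _))

theorem closure_sup_center_eq_top {f : G →* H} (hf : f.ker ≤ Subgroup.center G) {S : Set G}
    (hS : Subgroup.closure (f '' S) = ⊤) : Subgroup.closure S ⊔ Subgroup.center G = ⊤ := by
  refine top_le_iff.1 (le_trans ?_ (sup_le_sup_left hf _))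
  rw [← Subgroup.comap_map_eq, MonoidHom.map_closure, hS, Subgroup.comap_top]

theorem commutator_le_zpowers_comm {a b : G}
    (hab : Subgroup.closure {a, b} ⊔ Subgroup.center G = ⊤)
    (hc : comm a b ∈ Subgroup.center G) : commutator G ≤ Subgroup.zpowers (comm a b) := by
  have hnormal : (Subgroup.zpowers (comm a b)).Normal :=
    normal_of_le_center ((Subgroup.zpowers_le).2 hc)
  let q := QuotientGroup.mk' (Subgroup.zpowers (comm a b))
  have hq := closure_image_sup_center_eq_top (QuotientGroup.mk'_surjective _) hab (f := q)
  rw [Set.image_pair] at hq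
  have hcomm : Commute (q a) (q b) := by
    rw [← comm_eq_one_iff, ← map_comm]
    exact (QuotientGroup.eq_one_iff _).2 (Subgroup.mem_zpowers _)
  have hgen : ∀ s ∈ ({q a, q b} : Set _), s ∈ Subgroup.center _ := by
    rintro s (rfl | rfl) <;> refine mem_center_of_closure_sup_center_eq_top hq ?_ <;>
      rintro t (rfl | rfl)
    exacts [.refl _, hcomm.symm, hcomm, .refl _]
  rw [← hnormal.quotient_commutative_iff_commutator_le, ← Subgroup.center_eq_top_iff]
  exact top_le_iff.1 (hq.ge.trans (sup_le ((Subgroup.closure_le _).2 hgen) le_rfl))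

section ModuloCentral

variable {N : Subgroup G} [N.Normal] {a b : G}

theorem mk_comm_mem_center (hab : Subgroup.closure {a, b} ⊔ Subgroup.center G = ⊤)
    (ha : comm a (comm a b) ∈ N) (hb : comm b (comm a b) ∈ N) :
    comm (a : G ⧸ N) (b : G ⧸ N) ∈ Subgroup.center (G ⧸ N) := by
  refine mem_center_of_closure_sup_center_eq_top
    (closure_image_sup_center_eq_top (QuotientGroup.mk'_surjective N) hab) ?_
  rw [Set.image_pair]
  rintro _ (rfl | rfl) <;> rw [← comm_eq_one_iff]
  exacts [(QuotientGroup.eq_one_iff _).2 ha, (QuotientGroup.eq_one_iff _).2 hb]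

theorem commutator_le_zpowers_comm_sup (hab : Subgroup.closure {a, b} ⊔ Subgroup.center G = ⊤)
    (ha : comm a (comm a b) ∈ N) (hb : comm b (comm a b) ∈ N) :
    commutator G ≤ Subgroup.zpowers (comm a b) ⊔ N := by
  have hq := closure_image_sup_center_eq_top (QuotientGroup.mk'_surjective N) hab
  rw [Set.image_pair] at hq
  calc
    commutator G ≤ (commutator (G ⧸ N)).comap (QuotientGroup.mk' N) :=
      Subgroup.map_le_iff_le_comap.1
        (map_commutator_eq_commutator (QuotientGroup.mk'_surjective N)).le
    _ ≤ ((Subgroup.zpowers (comm a b)).map (QuotientGroup.mk' N)).comap (QuotientGroup.mk' N) := by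
      refine Subgroup.comap_mono ?_
      rw [MonoidHom.map_zpowers]
      exact commutator_le_zpowers_comm hq (mk_comm_mem_center hab ha hb)
    _ = Subgroup.zpowers (comm a b) ⊔ N := by rw [Subgroup.comap_map_eq, QuotientGroup.ker_mk']

theorem comm_pow_mem {n : ℕ} (hab : Subgroup.closure {a, b} ⊔ Subgroup.center G = ⊤)
    (ha : comm a (comm a b) ∈ N) (hb : comm b (comm a b) ∈ N) (han : a ^ n ∈ Subgroup.center G) :
    comm a b ^ n ∈ N := by
  refine (QuotientGroup.eq_one_iff _).1 (comm_pow_eq_one (mk_comm_mem_center hab ha hb) ?_)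
  exact map_center_le_center (QuotientGroup.mk'_surjective N) (Subgroup.mem_map_of_mem _ han)

end ModuloCentral

theorem exists_zpow_mul_zpow_mul {a b : G} (hab : Subgroup.closure {a, b} = ⊤) (x : G) :
    ∃ i j : ℤ, ∃ z ∈ commutator G, a ^ i * b ^ j * z = x := by
  have hx : Abelianization.of x ∈
      Subgroup.closure {Abelianization.of a, Abelianization.of b} := by
    rw [← Set.image_pair, ← MonoidHom.map_closure, hab]
    exact Subgroup.mem_map_of_mem _ (Subgroup.mem_top x)
  obtain ⟨i, j, hij⟩ := Subgroup.mem_closure_pair.1 hx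
  refine ⟨i, j, (a ^ i * b ^ j)⁻¹ * x, ?_, mul_inv_cancel_left _ _⟩
  rw [← Abelianization.ker_of, MonoidHom.mem_ker, map_mul, map_inv, map_mul, map_zpow, map_zpow,
    hij, inv_mul_cancel]

open scoped Pointwise in
theorem finite_and_card_zpowers_sup_zpowers_le {u v : G} {n : ℕ} (hn : 0 < n)
    (hu : u ^ n = 1) (hv : v ^ n = 1) (hvc : v ∈ Subgroup.center G) :
    Finite ↥(Subgroup.zpowers u ⊔ Subgroup.zpowers v) ∧
      Nat.card ↥(Subgroup.zpowers u ⊔ Subgroup.zpowers v) ≤ n ^ 2 := by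
  have := normal_of_le_center ((Subgroup.zpowers_le).2 hvc)
  have hcoe := Subgroup.mul_normal (Subgroup.zpowers u) (Subgroup.zpowers v)
  have hfin {x : G} (hx : x ^ n = 1) : (Subgroup.zpowers x : Set G).Finite :=
    (isOfFinOrder_iff_pow_eq_one.2 ⟨n, hn, hx⟩).finite_zpowers
  have hcard {x : G} (hx : x ^ n = 1) : Nat.card (Subgroup.zpowers x) ≤ n := by
    rw [Nat.card_zpowers]
    exact orderOf_le_of_pow_eq_one hn hx
  constructor
  · exact ((hfin hu).mul (hfin hv)).subset hcoe.le
  · calc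
      _ = Nat.card ((Subgroup.zpowers u : Set G) * (Subgroup.zpowers v : Set G) : Set G) :=
        Nat.card_congr (Equiv.setCongr hcoe)
      _ ≤ Nat.card (Subgroup.zpowers u) * Nat.card (Subgroup.zpowers v) := Set.natCard_mul_le
      _ ≤ n * n := Nat.mul_le_mul (hcard hu) (hcard hv)
      _ = n ^ 2 := (sq n).symm

end Commutators

/-! ### Central and stem extensions -/

section Extensions

variable {P E F G H : Type*} [Group P] [Group E] [Group F] [Group G] [Group H]

theorem disjoint_ker_commutator {α : P →* E} (hα : Function.Surjective α) {π : E →* G}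
    (hπ : π.ker ≤ commutator E) [Finite ↥((π.comp α).ker ⊓ commutator P)]
    (hcard : Nat.card ↥((π.comp α).ker ⊓ commutator P) ≤ Nat.card π.ker) :
    Disjoint α.ker (commutator P) := by
  let φ : ↥((π.comp α).ker ⊓ commutator P) →* π.ker :=
    (α.comp (Subgroup.subtype _)).codRestrict _ fun z => z.2.1
  have hsurj : Function.Surjective φ := by
    rintro ⟨t, ht⟩
    obtain ⟨z, hz, rfl⟩ := (map_commutator_eq_commutator hα).ge (hπ ht)
    exact ⟨⟨z, ht, hz⟩, rfl⟩
  have hinj : Function.Injective φ :=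
    ((Nat.bijective_iff_surjective_and_card φ).2
      ⟨hsurj, hcard.antisymm (Nat.card_le_card_of_surjective φ hsurj)⟩).1
  rw [Subgroup.disjoint_def]
  intro z (hz : α z = 1) hzP
  have hzK : z ∈ (π.comp α).ker ⊓ commutator P :=
    ⟨(congrArg π hz).trans (map_one π), hzP⟩
  have hφz : φ ⟨z, hzK⟩ = 1 := Subtype.ext hz
  exact congrArg Subtype.val (hinj (hφz.trans (map_one φ).symm))

/-- The fibre product `E ×_G F` of two groups over `G`. -/
abbrev fibreProduct (π : E →* G) (ρ : F →* G) : Subgroup (E × F) :=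
  (π.comp (MonoidHom.fst E F)).eqLocus (ρ.comp (MonoidHom.snd E F))

namespace fibreProduct

variable (π : E →* G) (ρ : F →* G)

/-- The first projection of a fibre product. -/
def fst : fibreProduct π ρ →* E := (MonoidHom.fst E F).comp (Subgroup.subtype _)

theorem fst_surjective {ρ : F →* G} (hρ : Function.Surjective ρ) :
    Function.Surjective (fst π ρ) := fun e =>
  let ⟨f, hf⟩ := hρ (π e)
  ⟨⟨(e, f), hf.symm⟩, rfl⟩

theorem ker_comp_fst_le_center {π : E →* G} {ρ : F →* G} (hπ : π.ker ≤ Subgroup.center E)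
    (hρ : ρ.ker ≤ Subgroup.center F) :
    (π.comp (fst π ρ)).ker ≤ Subgroup.center (fibreProduct π ρ) := by
  rintro ⟨⟨e, f⟩, hef⟩ (he : π e = 1)
  have hf : ρ f = 1 := hef.symm.trans he
  refine Subgroup.mem_center_iff.2 fun ⟨⟨e', f'⟩, _⟩ => Subtype.ext (Prod.ext ?_ ?_)
  exacts [Subgroup.mem_center_iff.1 (hπ he) e', Subgroup.mem_center_iff.1 (hρ hf) f']

end fibreProduct

theorem commute_of_commute_of_card_le {π : E →* G} {ρ : F →* G} (hπ : π.ker ≤ commutator E)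
    (hρ : Function.Surjective ρ)
    [Finite ↥((π.comp (fibreProduct.fst π ρ)).ker ⊓ commutator (fibreProduct π ρ))]
    (hcard : Nat.card ↥((π.comp (fibreProduct.fst π ρ)).ker ⊓ commutator (fibreProduct π ρ)) ≤
      Nat.card π.ker) {a b : E} {a' b' : F} (ha : π a = ρ a') (hb : π b = ρ b')
    (hab : Commute a b) : Commute a' b' := by
  let x : fibreProduct π ρ := ⟨(a, a'), ha⟩
  let y : fibreProduct π ρ := ⟨(b, b'), hb⟩
  have hker : comm x y ∈ (fibreProduct.fst π ρ).ker := by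
    rw [MonoidHom.mem_ker, map_comm]
    exact comm_eq_one_iff.2 hab
  have hone := Subgroup.disjoint_def.1
    (disjoint_ker_commutator (fibreProduct.fst_surjective π hρ) hπ hcard) hker
    (comm_mem_commutator x y)
  exact comm_eq_one_iff.1 (congrArg (fun z => z.1.2) hone)

namespace IsStemExtension

theorem card_eq {π : E →* G} (hπ : IsStemExtension π) :
    Nat.card E = Nat.card G * Nat.card π.ker := by
  rw [Subgroup.card_eq_card_quotient_mul_card_subgroup π.ker,
    Nat.card_congr (QuotientGroup.quotientKerEquivOfSurjective π hπ.surjective).toEquiv]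

theorem comp_mulEquiv {π : E →* G} (hπ : IsStemExtension π) (e : F ≃* E) :
    IsStemExtension (π.comp (e : F →* E)) where
  surjective := hπ.surjective.comp e.surjective
  ker_le_center := by
    rw [MonoidHom.ker_comp_mulEquiv]
    exact (Subgroup.map_mono hπ.ker_le_center).trans (map_center_le_center e.symm.surjective)
  ker_le_commutator := by
    rw [MonoidHom.ker_comp_mulEquiv,
      ← map_commutator_eq_commutator (f := (e.symm : E →* F)) e.symm.surjective]
    exact Subgroup.map_mono hπ.ker_le_commutator

theorem mulEquiv_comp {π : E →* G} (hπ : IsStemExtension π) (e : G ≃* H) :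
    IsStemExtension ((e : G →* H).comp π) where
  surjective := e.surjective.comp hπ.surjective
  ker_le_center := by
    rw [MonoidHom.ker_mulEquiv_comp]
    exact hπ.ker_le_center
  ker_le_commutator := by
    rw [MonoidHom.ker_mulEquiv_comp]
    exact hπ.ker_le_commutator

end IsStemExtension

end Extensions

/-! ### The Heisenberg group in logarithmic coordinates -/

section Models

variable {R : Type*}

/-- The Heisenberg group over a commutative ring `R` in which `2` is invertible, in logarithmic
coordinates: `⟨a, b, c⟩` is the exponential of the strictly upper triangular matrix with entries
`a`, `b` next to the diagonal and `c` in the corner, and the group law is the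
Baker–Campbell–Hausdorff formula. -/
@[ext]
structure HeisenbergModel (R : Type*) where
  a : R
  b : R
  c : R

namespace HeisenbergModel

/-- The vector of logarithmic coordinates. -/
def vec (x : HeisenbergModel R) : Fin 3 → R :=
  ![x.a, x.b, x.c]

theorem vec_injective : Function.Injective (vec : HeisenbergModel R → Fin 3 → R) := fun _ _ h =>
  HeisenbergModel.ext (congrFun h 0) (congrFun h 1) (congrFun h 2)

theorem vec_surjective : Function.Surjective (vec : HeisenbergModel R → Fin 3 → R) := fun v =>
  ⟨⟨v 0, v 1, v 2⟩, by ext i; fin_cases i <;> rfl⟩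

instance [Finite R] : Finite (HeisenbergModel R) :=
  .of_injective vec vec_injective

variable [CommRing R]

theorem minorsVanish_vec_iff {x y : HeisenbergModel R} : MinorsVanish x.vec y.vec ↔
    x.a * y.b = x.b * y.a ∧ x.a * y.c = x.c * y.a ∧ x.b * y.c = x.c * y.b := by
  refine ⟨fun h => ⟨h 0 1, h 0 2, h 1 2⟩, fun ⟨hab, hac, hbc⟩ i j => ?_⟩
  fin_cases i <;> fin_cases j
  exacts [rfl, hab, hac, hab.symm, rfl, hbc, hac.symm, hbc.symm, rfl]

instance : One (HeisenbergModel R) := ⟨⟨0, 0, 0⟩⟩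

theorem one_def : (1 : HeisenbergModel R) = ⟨0, 0, 0⟩ := rfl

instance : Inv (HeisenbergModel R) := ⟨fun x => ⟨-x.a, -x.b, -x.c⟩⟩

theorem inv_def (x : HeisenbergModel R) : x⁻¹ = ⟨-x.a, -x.b, -x.c⟩ := rfl

variable [Invertible (2 : R)]

instance : Mul (HeisenbergModel R) :=
  ⟨fun x y => ⟨x.a + y.a, x.b + y.b, x.c + y.c + ⅟2 * (x.a * y.b - x.b * y.a)⟩⟩

theorem mul_def (x y : HeisenbergModel R) :
    x * y = ⟨x.a + y.a, x.b + y.b, x.c + y.c + ⅟2 * (x.a * y.b - x.b * y.a)⟩ := rfl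

instance : Group (HeisenbergModel R) :=
  .ofLeftAxioms (fun x y z => by ext <;> simp only [mul_def] <;> ring)
    (fun x => by ext <;> simp [mul_def, one_def])
    (fun x => by ext <;> simp [mul_def, one_def, inv_def, mul_comm])

theorem zpow_def (x : HeisenbergModel R) (i : ℤ) : x ^ i = ⟨i * x.a, i * x.b, i * x.c⟩ := by
  let φ : Multiplicative R →* HeisenbergModel R :=
    { toFun r := ⟨r.toAdd * x.a, r.toAdd * x.b, r.toAdd * x.c⟩
      map_one' := by simp [one_def]
      map_mul' r s := by ext <;> simp only [mul_def, toAdd_mul] <;> ring }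
  simpa [φ] using (map_zpow φ (.ofAdd 1) i).symm

theorem mem_zpowers_iff {n : ℕ} [Invertible (2 : ZMod n)] {x g : HeisenbergModel (ZMod n)} :
    x ∈ Subgroup.zpowers g ↔ x.vec ∈ ZMod n ∙ g.vec := by
  rw [Subgroup.mem_zpowers_iff, Submodule.mem_span_singleton, ZMod.intCast_surjective.exists]
  refine exists_congr fun i => ?_
  rw [← vec_injective.eq_iff, zpow_def]
  simp [vec]

theorem exists_mem_zpowers_iff {n : ℕ} [Invertible (2 : ZMod n)] {x y : HeisenbergModel (ZMod n)} :
    (∃ g, x ∈ Subgroup.zpowers g ∧ y ∈ Subgroup.zpowers g) ↔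
      ∃ z, x.vec ∈ ZMod n ∙ z ∧ y.vec ∈ ZMod n ∙ z := by
  simp only [mem_zpowers_iff, vec_surjective.exists]

/-- The abelianization map of the Heisenberg group, with coordinates `a`, `b`. -/
def toPair :
    HeisenbergModel R →* Multiplicative (R × R) where
  toFun x := .ofAdd (x.a, x.b)
  map_one' := rfl
  map_mul' _ _ := rfl

theorem ker_toPair_le_center :
    (toPair (R := R)).ker ≤ Subgroup.center (HeisenbergModel R) := by
  intro z (hz : (z.a, z.b) = (0, 0))
  obtain ⟨ha : z.a = 0, hb : z.b = 0⟩ := Prod.ext_iff.1 hz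
  refine Subgroup.mem_center_iff.2 fun x => ?_
  simp [mul_def, ha, hb, add_comm]

instance : Group.IsNilpotent (HeisenbergModel R) :=
  Subgroup.isNilpotent_of_ker_le_center _ ker_toPair_le_center

/-- The standard generators. -/
def gen : HGen → HeisenbergModel R
  | .y₁ => ⟨1, 0, 0⟩
  | .y₂ => ⟨0, 1, 0⟩
  | .w => ⟨0, 0, 1⟩

theorem gen_zpow_mul_gen_zpow_mul (i j l : ℤ) :
    gen .y₁ ^ i * gen .y₂ ^ j * gen .w ^ l = (⟨i, j, l + ⅟2 * (i * j)⟩ : HeisenbergModel R) := by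
  simp [gen, zpow_def, mul_def, add_comm]

theorem comm_gen_y₁_gen_y₂ : comm (gen .y₁) (gen .y₂) = (gen .w : HeisenbergModel R) := by
  rw [comm_eq_iff]
  ext <;> simp only [gen, mul_def]
  · ring
  · ring
  · linear_combination invOf_mul_self (2 : R)

theorem comm_gen_w (x : HeisenbergModel R) : comm x (gen .w) = 1 := by
  rw [comm_eq_one_iff, commute_iff_eq]
  ext <;> simp only [gen, mul_def] <;> ring

end HeisenbergModel

/-- The covering group of the Heisenberg group over a commutative ring `R` in which `2` is
invertible. It is a central extension by `R × R`, with coordinates `u`, `v`; the cubic terms of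
its group law are chosen so as to avoid the coefficient `1 / 12` of the
Baker–Campbell–Hausdorff formula, since `3` need not be invertible. -/
@[ext]
structure CoverModel (R : Type*) extends HeisenbergModel R where
  u : R
  v : R

namespace CoverModel

variable [CommRing R]

instance : One (CoverModel R) := ⟨⟨1, 0, 0⟩⟩

theorem one_def : (1 : CoverModel R) = ⟨⟨0, 0, 0⟩, 0, 0⟩ := rfl

instance : Inv (CoverModel R) := ⟨fun x => ⟨x.toHeisenbergModel⁻¹, -x.u, -x.v⟩⟩

theorem inv_def (x : CoverModel R) : x⁻¹ = ⟨⟨-x.a, -x.b, -x.c⟩, -x.u, -x.v⟩ := rfl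

variable [Invertible (2 : R)]

instance : Mul (CoverModel R) :=
  ⟨fun x y => ⟨x.toHeisenbergModel * y.toHeisenbergModel,
    x.u + y.u + ⅟2 * (x.a * y.c - x.c * y.a) - ⅟2 * ⅟2 * (x.a * y.a * (x.b + y.b)),
    x.v + y.v + ⅟2 * (x.b * y.c - x.c * y.b) + ⅟2 * ⅟2 * (x.b * y.b * (x.a + y.a))⟩⟩

theorem mul_def (x y : CoverModel R) : x * y = ⟨x.toHeisenbergModel * y.toHeisenbergModel,
    x.u + y.u + ⅟2 * (x.a * y.c - x.c * y.a) - ⅟2 * ⅟2 * (x.a * y.a * (x.b + y.b)),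
    x.v + y.v + ⅟2 * (x.b * y.c - x.c * y.b) + ⅟2 * ⅟2 * (x.b * y.b * (x.a + y.a))⟩ := rfl

instance : Group (CoverModel R) :=
  .ofLeftAxioms
    (fun x y z => by ext <;> simp only [mul_def, HeisenbergModel.mul_def] <;> ring)
    (fun x => by ext <;> simp [mul_def, one_def, HeisenbergModel.mul_def])
    (fun x => by ext <;> simp [mul_def, one_def, inv_def, HeisenbergModel.mul_def, mul_comm])

theorem zpow_def {x : CoverModel R} (hx : x.a * x.b = 0) (i : ℤ) :
    x ^ i = ⟨⟨i * x.a, i * x.b, i * x.c⟩, i * x.u, i * x.v⟩ := by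
  let φ : Multiplicative R →* CoverModel R :=
    { toFun r := ⟨⟨r.toAdd * x.a, r.toAdd * x.b, r.toAdd * x.c⟩, r.toAdd * x.u, r.toAdd * x.v⟩
      map_one' := by simp [one_def]
      map_mul' r s := by
        ext <;> simp only [mul_def, HeisenbergModel.mul_def, toAdd_mul]
        · ring
        · ring
        · ring
        · linear_combination ⅟2 * ⅟2 * r.toAdd * s.toAdd * (r.toAdd + s.toAdd) * x.a * hx
        · linear_combination -⅟2 * ⅟2 * r.toAdd * s.toAdd * (r.toAdd + s.toAdd) * x.b * hx }
  simpa [φ] using (map_zpow φ (.ofAdd 1) i).symm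

theorem commute_iff {x y : CoverModel R} :
    Commute x y ↔ MinorsVanish x.toHeisenbergModel.vec y.toHeisenbergModel.vec := by
  have half : ⅟(2 : R) * 2 = 1 := invOf_mul_self _
  rw [HeisenbergModel.minorsVanish_vec_iff, commute_iff_eq, CoverModel.ext_iff]
  simp only [mul_def, HeisenbergModel.mul_def]
  constructor
  · rintro ⟨-, -, hc, hu, hv⟩
    refine ⟨?_, ?_, ?_⟩
    · linear_combination hc - (x.a * y.b - x.b * y.a) * half
    · linear_combination hu - (x.a * y.c - x.c * y.a) * half
    · linear_combination hv - (x.b * y.c - x.c * y.b) * half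
  · rintro ⟨hab, hac, hbc⟩
    refine ⟨add_comm _ _, add_comm _ _, ?_, ?_, ?_⟩
    · linear_combination 2 * ⅟2 * hab
    · linear_combination 2 * ⅟2 * hac
    · linear_combination 2 * ⅟2 * hbc

/-- The standard generators. -/
def gen : CGen → CoverModel R
  | .y₁ => ⟨⟨1, 0, 0⟩, 0, 0⟩
  | .y₂ => ⟨⟨0, 1, 0⟩, 0, 0⟩
  | .w => ⟨⟨0, 0, 1⟩, -⅟2, -⅟2⟩
  | .w₁ => ⟨⟨0, 0, 0⟩, 1, 0⟩
  | .w₂ => ⟨⟨0, 0, 0⟩, 0, 1⟩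

theorem comm_gen_y₁_gen_y₂ : comm (gen .y₁) (gen .y₂) = (gen .w : CoverModel R) := by
  rw [comm_eq_iff]
  have half : ⅟(2 : R) * 2 = 1 := invOf_mul_self _
  ext <;> simp only [gen, mul_def, HeisenbergModel.mul_def]
  · ring
  · ring
  · linear_combination half
  · ring
  · ring

theorem comm_gen_w (x : CoverModel R) : comm x (gen .w) = ⟨⟨0, 0, 0⟩, x.a, x.b⟩ := by
  rw [comm_eq_iff]
  have half : ⅟(2 : R) * 2 = 1 := invOf_mul_self _
  ext <;> simp only [gen, mul_def, HeisenbergModel.mul_def]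
  · ring
  · ring
  · ring
  · linear_combination x.a * half
  · linear_combination x.b * half

theorem gen_zpow_mul_gen_zpow_mul (i j l r s : ℤ) :
    gen .y₁ ^ i * gen .y₂ ^ j * gen .w ^ l * gen .w₁ ^ r * gen .w₂ ^ s =
      (⟨⟨i, j, l + ⅟2 * (i * j)⟩, r + ⅟2 * (l * (i - 1)), s + ⅟2 * (l * (j - 1))⟩ :
        CoverModel R) := by
  rw [zpow_def (by simp [gen]), zpow_def (by simp [gen]), zpow_def (by simp [gen]),
    zpow_def (by simp [gen]), zpow_def (by simp [gen])]
  ext <;> simp only [gen, mul_def, HeisenbergModel.mul_def] <;> ring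

/-- The projection of the covering group onto the Heisenberg group. -/
def proj : CoverModel R →* HeisenbergModel R where
  toFun := toHeisenbergModel
  map_one' := rfl
  map_mul' _ _ := rfl

theorem eq_mk_of_mem_ker_proj {z : CoverModel R} (hz : z ∈ (proj (R := R)).ker) :
    z = ⟨⟨0, 0, 0⟩, z.u, z.v⟩ := by
  obtain ⟨_, u, v⟩ := z
  obtain rfl := MonoidHom.mem_ker.1 hz
  rfl

theorem isStemExtension_proj : IsStemExtension (proj (R := R)) where
  surjective x := ⟨⟨x, 0, 0⟩, rfl⟩
  ker_le_center z hz := by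
    rw [eq_mk_of_mem_ker_proj hz]
    refine Subgroup.mem_center_iff.2 fun x => commute_iff.2 ?_
    rw [HeisenbergModel.minorsVanish_vec_iff]
    simp
  ker_le_commutator z hz := by
    rw [eq_mk_of_mem_ker_proj hz, ← comm_gen_w ⟨⟨z.u, z.v, 0⟩, 0, 0⟩]
    exact comm_mem_commutator _ _

/-- The kernel of the projection is the additive group of pairs `(u, v)`. -/
def kerProjEquiv : (proj (R := R)).ker ≃* Multiplicative R × Multiplicative R where
  toFun z := (.ofAdd z.1.u, .ofAdd z.1.v)
  invFun p := ⟨⟨⟨0, 0, 0⟩, p.1.toAdd, p.2.toAdd⟩, rfl⟩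
  left_inv z := Subtype.ext (eq_mk_of_mem_ker_proj z.2).symm
  right_inv _ := rfl
  map_mul' z z' := by
    rw [Subgroup.coe_mul, eq_mk_of_mem_ker_proj z.2, eq_mk_of_mem_ker_proj z'.2, mul_def]
    simp

instance : Group.IsNilpotent (CoverModel R) :=
  Subgroup.isNilpotent_of_ker_le_center _ (isStemExtension_proj (R := R)).ker_le_center

theorem nilpotencyClass_le_three : Group.nilpotencyClass (CoverModel R) ≤ 3 := by
  calc
    Group.nilpotencyClass (CoverModel R) ≤ Group.nilpotencyClass (HeisenbergModel R) + 1 :=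
      Group.nilpotencyClass_le_of_ker_le_center _ (isStemExtension_proj (R := R)).ker_le_center
    _ ≤ Group.nilpotencyClass (Multiplicative (R × R)) + 1 + 1 := by
      gcongr
      exact Group.nilpotencyClass_le_of_ker_le_center _ HeisenbergModel.ker_toPair_le_center
    _ ≤ 1 + 1 + 1 := by
      gcongr
      exact CommGroup.nilpotencyClass_le_one

theorem nilpotencyClass_eq_three [Nontrivial R] : Group.nilpotencyClass (CoverModel R) = 3 := by
  refine le_antisymm nilpotencyClass_le_three ?_
  by_contra! hlt
  have hbot := Subgroup.lowerCentralSeries_eq_bot_iff_nilpotencyClass_le.2 (Nat.le_of_lt_succ hlt)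
  have hmem := comm_comm_mem_lowerCentralSeries_two (gen .y₁ : CoverModel R) (gen .y₁) (gen .y₂)
  rw [hbot, comm_gen_y₁_gen_y₂, comm_gen_w] at hmem
  exact one_ne_zero (congrArg u (Subgroup.mem_bot.1 hmem))

end CoverModel

end Models

/-! ### The presented groups -/

section Presentations

variable {n : ℕ}

theorem zpow_eq_one_of_intCast_eq_zero {G : Type*} [Group G] {g : G} (hg : g ^ n = 1) {i : ℤ}
    (hi : (i : ZMod n) = 0) : g ^ i = 1 := by
  obtain ⟨k, rfl⟩ := (ZMod.intCast_zmod_eq_zero_iff_dvd i n).1 hi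
  rw [zpow_mul, zpow_natCast, hg, one_zpow]

noncomputable instance [h : Fact (Odd n)] : Invertible (2 : ZMod n) :=
  IsUnit.invertible (by simpa using (ZMod.isUnit_iff_coprime 2 n).2 h.out.coprime_two_left)

instance [h : Fact (Odd n)] : NeZero n :=
  ⟨h.out.pos.ne'⟩

theorem HeisenbergModel.gen_pow [Invertible (2 : ZMod n)] (s : HGen) :
    (gen s : HeisenbergModel (ZMod n)) ^ n = 1 := by
  rw [← zpow_natCast, zpow_def]
  simp [one_def]

theorem CoverModel.gen_pow [Invertible (2 : ZMod n)] (s : CGen) :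
    (gen s : CoverModel (ZMod n)) ^ n = 1 := by
  rw [← zpow_natCast, zpow_def (by cases s <;> simp [gen])]
  simp [one_def]

namespace Heisenberg

theorem of_pow (s : HGen) : (PresentedGroup.of s : Heisenberg n) ^ n = 1 :=
  PresentedGroup.one_of_mem (x := FreeGroup.of s ^ n) (by cases s <;> simp [heisenbergRels])

theorem comm_y₁_y₂ :
    comm (PresentedGroup.of .y₁ : Heisenberg n) (PresentedGroup.of .y₂) = PresentedGroup.of .w :=
  (map_comm (PresentedGroup.mk _) _ _).symm.trans <|
    PresentedGroup.mk_eq_mk_of_mul_inv_mem (by simp [heisenbergRels])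

theorem commute_w {s : HGen} (hs : s = .y₁ ∨ s = .y₂) :
    Commute (PresentedGroup.of s : Heisenberg n) (PresentedGroup.of .w) :=
  comm_eq_one_iff.1 <| (map_comm (PresentedGroup.mk _) _ _).symm.trans <|
    PresentedGroup.one_of_mem (by obtain rfl | rfl := hs <;> simp [heisenbergRels])

theorem eq_top_of_mem {K : Subgroup (Heisenberg n)} (hy₁ : PresentedGroup.of .y₁ ∈ K)
    (hy₂ : PresentedGroup.of .y₂ ∈ K) : K = ⊤ := by
  rw [← top_le_iff, ← PresentedGroup.closure_range_of, Subgroup.closure_le]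
  rintro _ ⟨_ | _ | _, rfl⟩
  exacts [hy₁, hy₂, comm_y₁_y₂ ▸ comm_mem hy₁ hy₂]

theorem closure_y₁_y₂ :
    Subgroup.closure {(PresentedGroup.of .y₁ : Heisenberg n), PresentedGroup.of .y₂} = ⊤ :=
  eq_top_of_mem (Subgroup.subset_closure (.inl rfl)) (Subgroup.subset_closure (.inr rfl))

theorem w_mem_center : (PresentedGroup.of .w : Heisenberg n) ∈ Subgroup.center _ := by
  refine mem_center_of_closure_sup_center_eq_top (by rw [closure_y₁_y₂, top_sup_eq]) ?_
  rintro _ (rfl | rfl)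
  exacts [commute_w (.inl rfl), commute_w (.inr rfl)]

theorem exists_normalForm (x : Heisenberg n) : ∃ i j l : ℤ,
    PresentedGroup.of .y₁ ^ i * PresentedGroup.of .y₂ ^ j * PresentedGroup.of .w ^ l = x := by
  obtain ⟨i, j, z, hz, rfl⟩ := exists_zpow_mul_zpow_mul closure_y₁_y₂ x
  obtain ⟨l, rfl⟩ := commutator_le_zpowers_comm (by rw [closure_y₁_y₂, top_sup_eq])
    (comm_y₁_y₂ (n := n) ▸ w_mem_center) hz
  exact ⟨i, j, l, by rw [comm_y₁_y₂]⟩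

variable [Fact (Odd n)]

/-- The homomorphism to the coordinate model matching the generators. -/
noncomputable def toModel : Heisenberg n →* HeisenbergModel (ZMod n) :=
  PresentedGroup.toGroup (f := HeisenbergModel.gen) <| by
    rintro r (rfl | rfl | rfl | rfl | rfl | rfl)
    · simp [map_comm, HeisenbergModel.comm_gen_y₁_gen_y₂]
    · simp [HeisenbergModel.gen_pow]
    · simp [HeisenbergModel.gen_pow]
    · simp [HeisenbergModel.gen_pow]
    · simp [map_comm, HeisenbergModel.comm_gen_w]
    · simp [map_comm, HeisenbergModel.comm_gen_w]

theorem toModel_of (s : HGen) : toModel (PresentedGroup.of s : Heisenberg n) = .gen s :=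
  PresentedGroup.toGroup.of _

theorem intCast_eq_zero_of_w_zpow_eq_one {l : ℤ}
    (hl : (PresentedGroup.of .w : Heisenberg n) ^ l = 1) : (l : ZMod n) = 0 := by
  have hmodel := congrArg (fun x => (toModel x).c) hl
  simpa [toModel_of, HeisenbergModel.zpow_def, HeisenbergModel.gen,
    HeisenbergModel.one_def] using hmodel

theorem toModel_normalForm (i j l : ℤ) :
    toModel (PresentedGroup.of .y₁ ^ i * PresentedGroup.of .y₂ ^ j * PresentedGroup.of .w ^ l :
      Heisenberg n) = ⟨i, j, l + ⅟2 * (i * j)⟩ := by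
  simp only [map_mul, map_zpow, toModel_of, HeisenbergModel.gen_zpow_mul_gen_zpow_mul]

theorem toModel_bijective :
    Function.Bijective (toModel : Heisenberg n → HeisenbergModel (ZMod n)) := by
  constructor
  · rw [injective_iff_map_eq_one]
    intro x hx
    obtain ⟨i, j, l, rfl⟩ := exists_normalForm x
    rw [toModel_normalForm, HeisenbergModel.one_def, HeisenbergModel.mk.injEq] at hx
    obtain ⟨hi, hj, hl⟩ := hx
    rw [hi, zero_mul, mul_zero, add_zero] at hl
    rw [zpow_eq_one_of_intCast_eq_zero (of_pow _) hi, zpow_eq_one_of_intCast_eq_zero (of_pow _) hj,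
      zpow_eq_one_of_intCast_eq_zero (of_pow _) hl, one_mul, one_mul]
  · rintro ⟨a, b, c⟩
    obtain ⟨i, rfl⟩ := ZMod.intCast_surjective a
    obtain ⟨j, rfl⟩ := ZMod.intCast_surjective b
    obtain ⟨l, hl⟩ := ZMod.intCast_surjective (n := n) (c - ⅟2 * (i * j))
    exact ⟨_, (toModel_normalForm i j l).trans (by rw [hl, sub_add_cancel])⟩

/-- The Heisenberg group is isomorphic to its coordinate model. -/
noncomputable def equivModel : Heisenberg n ≃* HeisenbergModel (ZMod n) :=
  .ofBijective toModel toModel_bijective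

theorem equivModel_of (s : HGen) : equivModel (PresentedGroup.of s : Heisenberg n) = .gen s :=
  toModel_of s

end Heisenberg

namespace HeisenbergCover

theorem of_pow (s : CGen) : (PresentedGroup.of s : HeisenbergCover n) ^ n = 1 :=
  PresentedGroup.one_of_mem (x := FreeGroup.of s ^ n) (by cases s <;> simp [heisenbergCoverRels])

theorem comm_y₁_y₂ : comm (PresentedGroup.of .y₁ : HeisenbergCover n) (PresentedGroup.of .y₂) =
    PresentedGroup.of .w :=
  (map_comm (PresentedGroup.mk _) _ _).symm.trans <|
    PresentedGroup.mk_eq_mk_of_mul_inv_mem (by simp [heisenbergCoverRels])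

theorem comm_y₁_w : comm (PresentedGroup.of .y₁ : HeisenbergCover n) (PresentedGroup.of .w) =
    PresentedGroup.of .w₁ :=
  (map_comm (PresentedGroup.mk _) _ _).symm.trans <|
    PresentedGroup.mk_eq_mk_of_mul_inv_mem (by simp [heisenbergCoverRels])

theorem comm_y₂_w : comm (PresentedGroup.of .y₂ : HeisenbergCover n) (PresentedGroup.of .w) =
    PresentedGroup.of .w₂ :=
  (map_comm (PresentedGroup.mk _) _ _).symm.trans <|
    PresentedGroup.mk_eq_mk_of_mul_inv_mem (by simp [heisenbergCoverRels])

theorem lowerCentralSeries_three :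
    (⊤ : Subgroup (HeisenbergCover n)).lowerCentralSeries 3 = ⊥ := by
  have hmap := Subgroup.map_lowerCentralSeries ⊤ (PresentedGroup.mk (heisenbergCoverRels n)) 3
  rw [Subgroup.map_top_of_surjective _ (PresentedGroup.mk_surjective _)] at hmap
  rw [← hmap, Subgroup.map_eq_bot_iff]
  exact fun r hr => PresentedGroup.one_of_mem (.inr hr)

theorem lowerCentralSeries_two_le_center :
    (⊤ : Subgroup (HeisenbergCover n)).lowerCentralSeries 2 ≤ Subgroup.center _ := by
  have h := lowerCentralSeries_three (n := n)
  rwa [Subgroup.lowerCentralSeries_succ, Subgroup.commutator_eq_bot_iff_le_centralizer,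
    Subgroup.coe_top, Subgroup.centralizer_univ] at h

theorem w₁_mem_center : (PresentedGroup.of .w₁ : HeisenbergCover n) ∈ Subgroup.center _ := by
  rw [← comm_y₁_w, ← comm_y₁_y₂]
  exact lowerCentralSeries_two_le_center (comm_comm_mem_lowerCentralSeries_two _ _ _)

theorem w₂_mem_center : (PresentedGroup.of .w₂ : HeisenbergCover n) ∈ Subgroup.center _ := by
  rw [← comm_y₂_w, ← comm_y₁_y₂]
  exact lowerCentralSeries_two_le_center (comm_comm_mem_lowerCentralSeries_two _ _ _)

theorem eq_top_of_mem {K : Subgroup (HeisenbergCover n)} (hy₁ : PresentedGroup.of .y₁ ∈ K)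
    (hy₂ : PresentedGroup.of .y₂ ∈ K) : K = ⊤ := by
  have hw : PresentedGroup.of .w ∈ K := comm_y₁_y₂ ▸ comm_mem hy₁ hy₂
  rw [← top_le_iff, ← PresentedGroup.closure_range_of, Subgroup.closure_le]
  rintro _ ⟨_ | _ | _ | _ | _, rfl⟩
  exacts [hy₁, hy₂, hw, comm_y₁_w ▸ comm_mem hy₁ hw, comm_y₂_w ▸ comm_mem hy₂ hw]

theorem closure_y₁_y₂ :
    Subgroup.closure {(PresentedGroup.of .y₁ : HeisenbergCover n), PresentedGroup.of .y₂} = ⊤ :=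
  eq_top_of_mem (Subgroup.subset_closure (.inl rfl)) (Subgroup.subset_closure (.inr rfl))

theorem exists_normalForm (x : HeisenbergCover n) : ∃ i j l r s : ℤ,
    PresentedGroup.of .y₁ ^ i * PresentedGroup.of .y₂ ^ j * PresentedGroup.of .w ^ l *
      PresentedGroup.of .w₁ ^ r * PresentedGroup.of .w₂ ^ s = x := by
  let N : Subgroup (HeisenbergCover n) :=
    Subgroup.zpowers (PresentedGroup.of .w₁) ⊔ Subgroup.zpowers (PresentedGroup.of .w₂)
  have hN : N ≤ Subgroup.center _ :=
    sup_le (Subgroup.zpowers_le.2 w₁_mem_center) (Subgroup.zpowers_le.2 w₂_mem_center)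
  have : N.Normal := normal_of_le_center hN
  have : (Subgroup.zpowers (PresentedGroup.of .w₂ : HeisenbergCover n)).Normal :=
    normal_of_le_center (Subgroup.zpowers_le.2 w₂_mem_center)
  obtain ⟨i, j, z, hz, rfl⟩ := exists_zpow_mul_zpow_mul closure_y₁_y₂ x
  have hz' := commutator_le_zpowers_comm_sup (N := N) (by rw [closure_y₁_y₂, top_sup_eq])
    (by rw [comm_y₁_y₂, comm_y₁_w]
        exact Subgroup.mem_sup_left (Subgroup.mem_zpowers _))
    (by rw [comm_y₁_y₂, comm_y₂_w]
        exact Subgroup.mem_sup_right (Subgroup.mem_zpowers _)) hz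
  obtain ⟨_, ⟨l, rfl⟩, t, ht, rfl⟩ := Subgroup.mem_sup_of_normal_right.1 hz'
  obtain ⟨_, ⟨r, rfl⟩, _, ⟨s, rfl⟩, rfl⟩ := Subgroup.mem_sup_of_normal_right.1 ht
  exact ⟨i, j, l, r, s, by simp only [comm_y₁_y₂, mul_assoc]⟩

variable [Fact (Odd n)]

/-- The homomorphism to the coordinate model matching the generators. -/
noncomputable def toModel : HeisenbergCover n →* CoverModel (ZMod n) :=
  PresentedGroup.toGroup (f := CoverModel.gen) <| by
    rintro r ((rfl | rfl | rfl | rfl | rfl | rfl | rfl | rfl) | hr)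
    · simp [map_comm, CoverModel.comm_gen_y₁_gen_y₂]
    · rw [map_mul, map_comm, map_inv, FreeGroup.lift_apply_of, FreeGroup.lift_apply_of,
        FreeGroup.lift_apply_of, CoverModel.comm_gen_w, mul_inv_eq_one]
      rfl
    · rw [map_mul, map_comm, map_inv, FreeGroup.lift_apply_of, FreeGroup.lift_apply_of,
        FreeGroup.lift_apply_of, CoverModel.comm_gen_w, mul_inv_eq_one]
      rfl
    iterate 5 simp [CoverModel.gen_pow]
    · have hbot := Subgroup.lowerCentralSeries_eq_bot_iff_nilpotencyClass_le.2
        (CoverModel.nilpotencyClass_le_three (R := ZMod n))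
      have hle : (Subgroup.map (FreeGroup.lift CoverModel.gen) ⊤).lowerCentralSeries 3 ≤
          (⊤ : Subgroup (CoverModel (ZMod n))).lowerCentralSeries 3 :=
        Subgroup.lowerCentralSeries_mono 3 le_top
      rw [hbot, ← Subgroup.map_lowerCentralSeries] at hle
      exact hle (Subgroup.mem_map_of_mem _ hr)

theorem toModel_of (s : CGen) : toModel (PresentedGroup.of s : HeisenbergCover n) = .gen s :=
  PresentedGroup.toGroup.of _

theorem toModel_normalForm (i j l r s : ℤ) :
    toModel (PresentedGroup.of .y₁ ^ i * PresentedGroup.of .y₂ ^ j * PresentedGroup.of .w ^ l *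
        PresentedGroup.of .w₁ ^ r * PresentedGroup.of .w₂ ^ s : HeisenbergCover n) =
      ⟨⟨i, j, l + ⅟2 * (i * j)⟩, r + ⅟2 * (l * (i - 1)), s + ⅟2 * (l * (j - 1))⟩ := by
  simp only [map_mul, map_zpow, toModel_of, CoverModel.gen_zpow_mul_gen_zpow_mul]

theorem toModel_bijective :
    Function.Bijective (toModel : HeisenbergCover n → CoverModel (ZMod n)) := by
  constructor
  · rw [injective_iff_map_eq_one]
    intro x hx
    obtain ⟨i, j, l, r, s, rfl⟩ := exists_normalForm x
    rw [toModel_normalForm, CoverModel.one_def, CoverModel.mk.injEq,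
      HeisenbergModel.mk.injEq] at hx
    obtain ⟨⟨hi, hj, hl⟩, hr, hs⟩ := hx
    rw [hi, zero_mul, mul_zero, add_zero] at hl
    rw [hl, zero_mul, mul_zero, add_zero] at hr hs
    rw [zpow_eq_one_of_intCast_eq_zero (of_pow _) hi, zpow_eq_one_of_intCast_eq_zero (of_pow _) hj,
      zpow_eq_one_of_intCast_eq_zero (of_pow _) hl, zpow_eq_one_of_intCast_eq_zero (of_pow _) hr,
      zpow_eq_one_of_intCast_eq_zero (of_pow _) hs]
    simp only [mul_one]
  · rintro ⟨⟨a, b, c⟩, u, v⟩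
    obtain ⟨i, rfl⟩ := ZMod.intCast_surjective a
    obtain ⟨j, rfl⟩ := ZMod.intCast_surjective b
    obtain ⟨l, hl⟩ := ZMod.intCast_surjective (n := n) (c - ⅟2 * (i * j))
    obtain ⟨r, hr⟩ := ZMod.intCast_surjective (n := n) (u - ⅟2 * (l * (i - 1)))
    obtain ⟨s, hs⟩ := ZMod.intCast_surjective (n := n) (v - ⅟2 * (l * (j - 1)))
    refine ⟨_, (toModel_normalForm i j l r s).trans ?_⟩
    rw [hr, hs, hl, sub_add_cancel, sub_add_cancel, sub_add_cancel]

/-- The covering group is isomorphic to its coordinate model. -/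
noncomputable def equivModel : HeisenbergCover n ≃* CoverModel (ZMod n) :=
  .ofBijective toModel toModel_bijective

theorem equivModel_of (s : CGen) : equivModel (PresentedGroup.of s : HeisenbergCover n) = .gen s :=
  toModel_of s

end HeisenbergCover

end Presentations

/-! ### Central extensions of the Heisenberg group -/

section Covers

variable {n : ℕ}

section Lifts

variable {E : Type*} [Group E] {π : E →* Heisenberg n} {a b : E}

theorem closure_lifts_sup_center_eq_top (hπ : π.ker ≤ Subgroup.center E)
    (ha : π a = PresentedGroup.of .y₁) (hb : π b = PresentedGroup.of .y₂) :
    Subgroup.closure {a, b} ⊔ Subgroup.center E = ⊤ :=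
  closure_sup_center_eq_top hπ (by rw [Set.image_pair, ha, hb, Heisenberg.closure_y₁_y₂])

theorem comm_comm_mem_ker {s : HGen} (hs : s = .y₁ ∨ s = .y₂) {g : E}
    (hg : π g = PresentedGroup.of s) (ha : π a = PresentedGroup.of .y₁)
    (hb : π b = PresentedGroup.of .y₂) : comm g (comm a b) ∈ π.ker := by
  rw [MonoidHom.mem_ker, map_comm, map_comm, hg, ha, hb, Heisenberg.comm_y₁_y₂, comm_eq_one_iff]
  exact Heisenberg.commute_w hs

theorem pow_mem_ker {s : HGen} {g : E} (hg : π g = PresentedGroup.of s) : g ^ n ∈ π.ker := by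
  rw [MonoidHom.mem_ker, map_pow, hg, Heisenberg.of_pow]

theorem ker_inf_commutator_le [Fact (Odd n)] (hπ : π.ker ≤ Subgroup.center E)
    (ha : π a = PresentedGroup.of .y₁) (hb : π b = PresentedGroup.of .y₂) :
    π.ker ⊓ commutator E ≤
      Subgroup.zpowers (comm a (comm a b)) ⊔ Subgroup.zpowers (comm b (comm a b)) := by
  set N := Subgroup.zpowers (comm a (comm a b)) ⊔ Subgroup.zpowers (comm b (comm a b))
  have hNker : N ≤ π.ker := sup_le
    (Subgroup.zpowers_le.2 (comm_comm_mem_ker (.inl rfl) ha ha hb))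
    (Subgroup.zpowers_le.2 (comm_comm_mem_ker (.inr rfl) hb ha hb))
  have : N.Normal := normal_of_le_center (hNker.trans hπ)
  have hab := closure_lifts_sup_center_eq_top hπ ha hb
  have hu : comm a (comm a b) ∈ N := Subgroup.mem_sup_left (Subgroup.mem_zpowers _)
  have hv : comm b (comm a b) ∈ N := Subgroup.mem_sup_right (Subgroup.mem_zpowers _)
  rintro z ⟨hz, hzE⟩
  obtain ⟨_, ⟨l, rfl⟩, t, ht, rfl⟩ :=
    Subgroup.mem_sup_of_normal_right.1 (commutator_le_zpowers_comm_sup hab hu hv hzE)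
  have hl : (PresentedGroup.of .w : Heisenberg n) ^ l = 1 := by
    rw [← Heisenberg.comm_y₁_y₂, ← ha, ← hb, ← map_comm, ← map_zpow]
    exact (mul_mem_cancel_right (hNker ht)).1 hz
  obtain ⟨m, rfl⟩ := (ZMod.intCast_zmod_eq_zero_iff_dvd l n).1
    (Heisenberg.intCast_eq_zero_of_w_zpow_eq_one hl)
  refine mul_mem ?_ ht
  simp only [zpow_mul, zpow_natCast]
  exact zpow_mem (comm_pow_mem hab hu hv (hπ (pow_mem_ker ha))) m

theorem finite_and_card_ker_inf_commutator_le [Fact (Odd n)] (hπ : Function.Surjective π)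
    (hker : π.ker ≤ Subgroup.center E) :
    Finite ↥(π.ker ⊓ commutator E) ∧ Nat.card ↥(π.ker ⊓ commutator E) ≤ n ^ 2 := by
  obtain ⟨a, ha⟩ := hπ (PresentedGroup.of .y₁)
  obtain ⟨b, hb⟩ := hπ (PresentedGroup.of .y₂)
  have hu := hker (comm_comm_mem_ker (.inl rfl) ha ha hb)
  have hv := hker (comm_comm_mem_ker (.inr rfl) hb ha hb)
  obtain ⟨hfin, hcard⟩ := finite_and_card_zpowers_sup_zpowers_le (NeZero.pos n)
    (comm_pow_eq_one hu (hker (pow_mem_ker ha))) (comm_pow_eq_one hv (hker (pow_mem_ker hb))) hv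
  have hle := ker_inf_commutator_le hker ha hb
  have : Finite ↥(π.ker ⊓ commutator E) := .of_injective _ (Subgroup.inclusion_injective hle)
  exact ⟨this, (Subgroup.card_le_of_le hle).trans hcard⟩

end Lifts

variable [Fact (Odd n)]

instance : Finite (Heisenberg n) :=
  .of_equiv _ Heisenberg.equivModel.symm.toEquiv

theorem IsStemExtension.card_ker_le {E : Type*} [Group E] {π : E →* Heisenberg n}
    (hπ : IsStemExtension π) : Nat.card π.ker ≤ n ^ 2 := by
  have hcard := (finite_and_card_ker_inf_commutator_le hπ.surjective hπ.ker_le_center).2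
  rwa [inf_eq_left.2 hπ.ker_le_commutator] at hcard

namespace HeisenbergCover

/-- The projection of the covering group onto the Heisenberg group matching the generators. -/
noncomputable def proj : HeisenbergCover n →* Heisenberg n :=
  ((Heisenberg.equivModel (n := n)).symm : HeisenbergModel (ZMod n) →* Heisenberg n).comp
    (CoverModel.proj.comp (equivModel (n := n) : HeisenbergCover n →* CoverModel (ZMod n)))

theorem equivModel_proj (x : HeisenbergCover n) :
    Heisenberg.equivModel (proj x) = (equivModel x).toHeisenbergModel :=
  Heisenberg.equivModel.apply_symm_apply _

theorem proj_y₁ : proj (PresentedGroup.of .y₁ : HeisenbergCover n) = PresentedGroup.of .y₁ := by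
  rw [← Heisenberg.equivModel.injective.eq_iff, equivModel_proj, equivModel_of,
    Heisenberg.equivModel_of]
  rfl

theorem proj_y₂ : proj (PresentedGroup.of .y₂ : HeisenbergCover n) = PresentedGroup.of .y₂ := by
  rw [← Heisenberg.equivModel.injective.eq_iff, equivModel_proj, equivModel_of,
    Heisenberg.equivModel_of]
  rfl

theorem proj_w : proj (PresentedGroup.of .w : HeisenbergCover n) = PresentedGroup.of .w := by
  rw [← comm_y₁_y₂, map_comm, proj_y₁, proj_y₂, Heisenberg.comm_y₁_y₂]

theorem isStemExtension_proj : IsStemExtension (proj (n := n)) :=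
  (CoverModel.isStemExtension_proj.comp_mulEquiv _).mulEquiv_comp _

theorem commute_iff {x y : HeisenbergCover n} : Commute x y ↔
    MinorsVanish (Heisenberg.equivModel (proj x)).vec (Heisenberg.equivModel (proj y)).vec := by
  rw [equivModel_proj, equivModel_proj, ← CoverModel.commute_iff]
  exact (commute_map_iff equivModel.injective).symm

/-- The kernel of the projection, the Schur multiplier, in the coordinates `u`, `v`. -/
noncomputable def kerProjEquiv :
    (proj (n := n)).ker ≃* Multiplicative (ZMod n) × Multiplicative (ZMod n) :=
  have hker : (proj (n := n)).ker = CoverModel.proj.ker.map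
      ((equivModel (n := n)).symm : CoverModel (ZMod n) →* HeisenbergCover n) :=
    (MonoidHom.ker_mulEquiv_comp _ _).trans (MonoidHom.ker_comp_mulEquiv _ _)
  (MulEquiv.subgroupCongr hker).trans
    ((equivModel.symm.subgroupMap CoverModel.proj.ker).symm.trans CoverModel.kerProjEquiv)

theorem card_ker_proj : Nat.card (proj (n := n)).ker = n ^ 2 := by
  rw [Nat.card_congr kerProjEquiv.toEquiv, Nat.card_prod, Nat.card_congr Multiplicative.toAdd,
    Nat.card_zmod, sq]

theorem nilpotencyClass_eq_three [Nontrivial (ZMod n)] :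
    Group.nilpotencyClass (HeisenbergCover n) = 3 := by
  have : Group.IsNilpotent (HeisenbergCover n) :=
    Subgroup.nilpotent_iff_lowerCentralSeries.2 ⟨3, lowerCentralSeries_three⟩
  refine (Subgroup.lowerCentralSeries_eq_bot_iff_nilpotencyClass_le.1
    lowerCentralSeries_three).antisymm ?_
  rw [← CoverModel.nilpotencyClass_eq_three (R := ZMod n)]
  exact Group.nilpotencyClass_le_of_surjective _ equivModel.surjective

end HeisenbergCover

theorem isSchurCover_iff {E : Type*} [Group E] {π : E →* Heisenberg n} :
    IsSchurCover π ↔ IsStemExtension π ∧ Nat.card π.ker = n ^ 2 := by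
  constructor
  · intro hπ
    refine ⟨hπ.stem, hπ.stem.card_ker_le.antisymm ?_⟩
    have hle := hπ.card_le _ _ HeisenbergCover.isStemExtension_proj
    rw [hπ.stem.card_eq, HeisenbergCover.isStemExtension_proj.card_eq,
      HeisenbergCover.card_ker_proj] at hle
    exact Nat.le_of_mul_le_mul_left hle Nat.card_pos
  · rintro ⟨hπ, hcard⟩
    refine ⟨hπ, fun F _ ρ hρ => ?_⟩
    rw [hρ.card_eq, hπ.card_eq, hcard]
    exact Nat.mul_le_mul_left _ hρ.card_ker_le

theorem IsSchurCover.commute_of_commute {E F : Type*} [Group E] [Group F]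
    {π : E →* Heisenberg n} {ρ : F →* Heisenberg n} (hπ : IsSchurCover π) (hρ : IsSchurCover ρ)
    {a b : E} {a' b' : F} (ha : π a = ρ a') (hb : π b = ρ b') (hab : Commute a b) :
    Commute a' b' := by
  obtain ⟨hfin, hcard⟩ := finite_and_card_ker_inf_commutator_le
    (π := π.comp (fibreProduct.fst π ρ))
    (hπ.stem.surjective.comp (fibreProduct.fst_surjective π hρ.stem.surjective))
    (fibreProduct.ker_comp_fst_le_center hπ.stem.ker_le_center hρ.stem.ker_le_center)
  rw [← (isSchurCover_iff.1 hπ).2] at hcard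
  exact commute_of_commute_of_card_le hπ.stem.ker_le_commutator hρ.stem.surjective hcard ha hb hab

theorem isSchurCover_proj : IsSchurCover (HeisenbergCover.proj (n := n)) :=
  isSchurCover_iff.2 ⟨HeisenbergCover.isStemExtension_proj, HeisenbergCover.card_ker_proj⟩

theorem IsSchurCover.commute_iff {E : Type*} [Group E] {π : E →* Heisenberg n}
    (hπ : IsSchurCover π) {a b : E} : Commute a b ↔
      MinorsVanish (Heisenberg.equivModel (π a)).vec (Heisenberg.equivModel (π b)).vec := by
  obtain ⟨a', ha⟩ := HeisenbergCover.isStemExtension_proj.surjective (π a)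
  obtain ⟨b', hb⟩ := HeisenbergCover.isStemExtension_proj.surjective (π b)
  rw [← ha, ← hb, ← HeisenbergCover.commute_iff]
  exact ⟨hπ.commute_of_commute isSchurCover_proj ha.symm hb.symm,
    isSchurCover_proj.commute_of_commute hπ ha hb⟩

end Covers

/-! ### The two graphs -/

section Graphs

theorem isCyclic_closure_pair_iff {G : Type*} [Group G] {x y : G} :
    IsCyclic (Subgroup.closure {x, y}) ↔
      ∃ g, x ∈ Subgroup.zpowers g ∧ y ∈ Subgroup.zpowers g := by
  constructor
  · intro h
    obtain ⟨g, hg⟩ := (Subgroup.isCyclic_iff_exists_zpowers_eq_top _).1 h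
    exact ⟨g, hg ▸ Subgroup.subset_closure (.inl rfl), hg ▸ Subgroup.subset_closure (.inr rfl)⟩
  · rintro ⟨g, hx, hy⟩
    refine Subgroup.isCyclic_of_le (H' := Subgroup.zpowers g) ((Subgroup.closure_le _).2 ?_)
    rintro _ (rfl | rfl)
    exacts [hx, hy]

variable {n : ℕ} [Fact (Odd n)]

theorem enhancedPowerGraph_adj_iff {x y : Heisenberg n} :
    (enhancedPowerGraph (Heisenberg n)).Adj x y ↔
      x ≠ y ∧ ∃ z, (Heisenberg.equivModel x).vec ∈ ZMod n ∙ z ∧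
        (Heisenberg.equivModel y).vec ∈ ZMod n ∙ z := by
  rw [← HeisenbergModel.exists_mem_zpowers_iff, Heisenberg.equivModel.surjective.exists]
  refine and_congr_right fun _ => isCyclic_closure_pair_iff.trans (exists_congr fun g => ?_)
  simp_rw [Subgroup.mem_zpowers_iff, ← map_zpow, Heisenberg.equivModel.injective.eq_iff]

theorem deepCommutingGraph_adj_iff {E : Type*} [Group E] {π : E →* Heisenberg n}
    (hπ : IsSchurCover π) {x y : Heisenberg n} : (deepCommutingGraph π).Adj x y ↔
      x ≠ y ∧ MinorsVanish (Heisenberg.equivModel x).vec (Heisenberg.equivModel y).vec := by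
  refine and_congr_right fun _ => ?_
  simp only [hπ.commute_iff]
  obtain ⟨a, rfl⟩ := hπ.stem.surjective x
  obtain ⟨b, rfl⟩ := hπ.stem.surjective y
  exact ⟨fun h => h a b rfl rfl, fun h a' b' ha hb => by rwa [ha, hb]⟩

theorem enhancedPowerGraph_eq_deepCommutingGraph_iff {E : Type*} [Group E]
    {π : E →* Heisenberg n} (hπ : IsSchurCover π) :
    enhancedPowerGraph (Heisenberg n) = deepCommutingGraph π ↔ Squarefree n := by
  have : IsPrincipalIdealRing (ZMod n) :=
    .of_surjective (Int.castRingHom _) ZMod.intCast_surjective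
  have hred : IsReduced (ZMod n) ↔ Squarefree n := by
    rw [isReduced_zmod, or_iff_left (NeZero.ne n)]
  rw [← hred, ← forall_minorsVanish_exists_iff_isReduced (ι := Fin 3)]
  have hvec : Function.Surjective fun x : Heisenberg n => (Heisenberg.equivModel x).vec :=
    HeisenbergModel.vec_surjective.comp Heisenberg.equivModel.surjective
  rw [hvec.forall₂]
  constructor
  · intro hgraph x y hxy
    rcases eq_or_ne x y with rfl | hne
    · exact ⟨_, Submodule.mem_span_singleton_self _, Submodule.mem_span_singleton_self _⟩
    · have hadj := (deepCommutingGraph_adj_iff hπ).2 ⟨hne, hxy⟩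
      rw [← hgraph] at hadj
      exact (enhancedPowerGraph_adj_iff.1 hadj).2
  · intro hminors
    ext x y
    rw [enhancedPowerGraph_adj_iff, deepCommutingGraph_adj_iff hπ]
    exact and_congr_right fun _ =>
      ⟨fun ⟨_, hx, hy⟩ => minorsVanish_of_mem_span_singleton hx hy, hminors x y⟩

end Graphs

end DeepCommuting

theorem mainTheorem9_general (n : ℕ) (hodd : Odd n) (hn : 1 < n) :
    (∃ π : HeisenbergCover n →* Heisenberg n,
      π (PresentedGroup.of .y₁) = PresentedGroup.of .y₁ ∧
      π (PresentedGroup.of .y₂) = PresentedGroup.of .y₂ ∧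
      π (PresentedGroup.of .w) = PresentedGroup.of .w ∧
      IsSchurCover π ∧
      Nonempty (π.ker ≃* Multiplicative (ZMod n) × Multiplicative (ZMod n))) ∧
    Group.nilpotencyClass (HeisenbergCover n) = 3 ∧
    (∀ (E : Type*) [Group E] (π : E →* Heisenberg n), IsSchurCover π →
      (enhancedPowerGraph (Heisenberg n) = deepCommutingGraph π ↔ Squarefree n)) := by
  have : Fact (Odd n) := ⟨hodd⟩
  have : Fact (1 < n) := ⟨hn⟩
  exact ⟨⟨HeisenbergCover.proj, HeisenbergCover.proj_y₁, HeisenbergCover.proj_y₂,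
      HeisenbergCover.proj_w, isSchurCover_proj, ⟨HeisenbergCover.kerProjEquiv⟩⟩,
    HeisenbergCover.nilpotencyClass_eq_three,
    fun _ _ _ hπ => enhancedPowerGraph_eq_deepCommutingGraph_iff hπ⟩

theorem mainTheorem9 (p k : ℕ) (hp : p.Prime) (hodd : Odd p) (hk : 1 ≤ k) :
    (∃ π : HeisenbergCover (p ^ k) →* Heisenberg (p ^ k),
      π (PresentedGroup.of .y₁) = PresentedGroup.of .y₁ ∧
      π (PresentedGroup.of .y₂) = PresentedGroup.of .y₂ ∧
      π (PresentedGroup.of .w) = PresentedGroup.of .w ∧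
      IsSchurCover π ∧
      Nonempty (π.ker ≃* Multiplicative (ZMod (p ^ k)) × Multiplicative (ZMod (p ^ k)))) ∧
    Group.nilpotencyClass (HeisenbergCover (p ^ k)) = 3 ∧
    (∀ (E : Type*) [Group E] (π : E →* Heisenberg (p ^ k)), IsSchurCover π →
      (enhancedPowerGraph (Heisenberg (p ^ k)) = deepCommutingGraph π ↔ k = 1)) := by
  have hsq : Squarefree (p ^ k) ↔ k = 1 := by
    rw [Nat.squarefree_pow_iff hp.ne_one (Nat.one_le_iff_ne_zero.1 hk),
      and_iff_right hp.prime.squarefree]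
  simpa only [hsq] using mainTheorem9_general (p ^ k) hodd.pow
    (Nat.one_lt_pow (Nat.one_le_iff_ne_zero.1 hk) hp.one_lt)
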